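/- Let $k$ be an algebraically closed field and let $H$ be a finite-dimensional semisimple Hopf algebra over $k$ with counit $\varepsilon$ and antipode $S$ (Sweedler notation $\Delta(a)=a_{(1)}\otimes a_{(2)}$). Suppose that the characteristic $p$ of $k$ satisfies $p>\dim_k(H)^{1/2}$, or that $p=0$. For $n\in\mathbb Z$ let $P_n:H\to H$ be the $n$-th Sweedler power map, $$P_n(a)=\begin{cases}a_{(1)}\cdots a_{(n)}, & n\ge 1,\\ \varepsilon(a)1, & n=0,\\ S(a_{(1)})\cdots S(a_{(-n)}), & n\le -1.\end{cases}$$ Then $H$ has a nonzero left integral, i.e. an element $\Lambda\neq0$ with $h\Lambda=\varepsilon(h)\Lambda$ for all $h\in H$. For every such $\Lambda$ the element $\mathbf u=S(\Lambda_{(2)})\Lambda_{(1)}$ is invertible, so that for a finite-dimensional representation $V$ of $H$ with character $\chi_V$ and $n\in\mathbb Z$ the $n$-th Frobenius–Schur indicator $\nu_n(V)=\chi_V(\mathbf u^{-1}P_n(\Lambda))$ is defined; and for every $n\in\mathbb Z$ the $n$-th Frobenius–Schur indicator of the left regular representation of $H$ is $$\nu_n(H)=\operatorname{tr}(S\circ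 P_{n-1}).$$ -/

import Mathlib

open scoped TensorProduct

namespace HopfFS

noncomputable section

variable (k : Type*) {H : Type*} [Field k] [Ring H] [HopfAlgebra k H]

/-- `Λ` is a left integral of `H`: `h * Λ = ε(h) Λ` for all `h`. -/
def IsLeftIntegral (Λ : H) : Prop :=
  ∀ h : H, h * Λ = Coalgebra.counit (R := k) h • Λ

/-- The element `u = S(Λ₍₂₎) Λ₍₁₎`. -/
def uElement (Λ : H) : H :=
  LinearMap.mul' k H
    ((HopfAlgebra.antipode k).rTensor H
      (TensorProduct.comm k H H (Coalgebra.comul (R := k) Λ)))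

variable (H) in
/-- The `n`-th Sweedler power map, for an integer `n`. Powers are taken for the convolution
product `(f * g)(a) = f(a₍₁₎) g(a₍₂₎)`, whose unit is `a ↦ ε(a) 1`, so that this is
`a ↦ a₍₁₎ ⋯ a₍ₙ₎` if `n ≥ 1`, it is `a ↦ ε(a) 1` if `n = 0`, and it is
`a ↦ S(a₍₁₎) ⋯ S(a₍₋ₙ₎)` if `n ≤ -1`. -/
def sweedlerPower : ℤ → (H →ₗ[k] H)
  | Int.ofNat m => ((WithConv.toConv (LinearMap.id : H →ₗ[k] H)) ^ m).ofConv
  | Int.negSucc m =>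
      ((WithConv.toConv (HopfAlgebra.antipode k : H →ₗ[k] H)) ^ (m + 1)).ofConv

section Representation

variable (V : Type*) [AddCommGroup V] [Module k V] [Module H V] [IsScalarTower k H V]

/-- The character `χ_V` of a representation `V`: the trace of the action of `h` on `V`. -/
def character (h : H) : k :=
  LinearMap.trace k V (Algebra.lsmul k k V h)

/-- The `n`-th Frobenius-Schur indicator `ν_n(V) = χ_V(u⁻¹ P_n(Λ))` of a representation `V`,
computed with the integral `Λ` (meaningful when `u = S(Λ₍₂₎) Λ₍₁₎` is a unit). -/
def fsIndicator (Λ : H) (n : ℤ) : k :=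
  character k V (Ring.inverse (uElement k Λ) * sweedlerPower k H n Λ)

end Representation

end

end HopfFS

/-!
By semisimplicity there is a left integral with value `1` under `ε`, found in a complement of the
augmentation ideal (`exists_mul_eq_smul_of_isSemisimpleRing`). This forces the antipode `S` to be
bijective (`antipode_injective`), every left integral to be a multiple of this one, to be two-sided
and to be fixed by `S` (`HopfFS.IsLeftIntegral.unimodular`).

For a nonzero left integral `Λ`, the tensor `∑ xⱼ ⊗ yⱼ = Λ₁ ⊗ S(Λ₂)` is a Casimir element,
`∑ a xⱼ ⊗ yⱼ = ∑ xⱼ ⊗ yⱼ a`, with `∑ xⱼ yⱼ = ε(Λ)` and `∑ yⱼ xⱼ = u` (`isCasimir_comul`).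
Moving matrix units across the tensor sign in `H ≅ ∏ Mat(dᵢ)` shows that in the `i`-th block,
`dᵢ ∑ⱼ (xⱼ)_{qb} (yⱼ)_{cr} = δ_{qr} u_{cb}`
(`IsCasimir.sum_entry_self`). The bound on the characteristic makes every `dᵢ` invertible in `k`,
because `∑ dᵢ² = dim H`. Thus `tr uᵢ = dᵢ ε(Λ) ≠ 0`, so no block of `u` vanishes. As `u a = S²(a) u`,
the left ideal `H u` is two-sided, and therefore `u` is invertible
(`IsCasimir.isUnit_of_block_ne_zero`).

The block formula also shows that the form `φ(a) = χ(u⁻¹ a)`, where `χ` is the character of the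
regular representation, is dual to the Casimir element: `∑ φ(yⱼ a) xⱼ = a`. Hence
`tr F = ∑ φ(yⱼ F(xⱼ))` for every endomorphism `F` (`IsCasimir.trace_eq_sum`). For `F = S ∘ P_{n-1}`
the argument of `φ` is `S(Λ₂) S(P_{n-1}(Λ₁)) = S(P_n(Λ))`. This equals `P_n(S(Λ)) = P_n(Λ)`, since `S`
reverses both products and coproducts (`antipode_sweedlerPower`), and `φ(P_n(Λ))` is the indicator.
-/

/-! ### Casimir elements of split semisimple algebras -/

/-- A finite family `∑ xⱼ ⊗ yⱼ` in `A ⊗ A` with `∑ a xⱼ ⊗ yⱼ = ∑ xⱼ ⊗ yⱼ a` for all `a`. -/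
def IsCasimir (k : Type*) {A σ : Type*} [CommRing k] [Ring A] [Algebra k A]
    (s : Finset σ) (x y : σ → A) : Prop :=
  ∀ a : A, ∑ j ∈ s, (a * x j) ⊗ₜ[k] y j = ∑ j ∈ s, x j ⊗ₜ[k] (y j * a)

namespace IsCasimir

section General

variable {k A σ : Type*} [CommRing k] [Ring A] [Algebra k A] {s : Finset σ} {x y : σ → A}

lemma sum_smul {M : Type*} [AddCommGroup M] [Module k M] (h : IsCasimir k s x y)
    (f : A →ₗ[k] k) (g : A →ₗ[k] M) (a : A) :
    ∑ j ∈ s, f (a * x j) • g (y j) = ∑ j ∈ s, f (x j) • g (y j * a) := by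
  simpa using congrArg (TensorProduct.lift ((LinearMap.lsmul k M).compl₂ g ∘ₗ f)) (h a)

lemma smul_sum {M : Type*} [AddCommGroup M] [Module k M] (h : IsCasimir k s x y)
    (f : A →ₗ[k] M) (g : A →ₗ[k] k) (a : A) :
    ∑ j ∈ s, g (y j) • f (a * x j) = ∑ j ∈ s, g (y j * a) • f (x j) := by
  simpa using congrArg (TensorProduct.lift ((LinearMap.lsmul k M).compl₂ f ∘ₗ g).flip) (h a)

end General

section Blocks

variable {k A σ I : Type*} [Field k] [Ring A] [Algebra k A] {s : Finset σ} {x y : σ → A}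
  {d : I → ℕ}

/-- The `(p, q)` entry of the `i`-th block, as a linear functional. -/
def entry (e : A ≃ₐ[k] Π i, Matrix (Fin (d i)) (Fin (d i)) k)
    (i : I) (p q : Fin (d i)) : A →ₗ[k] k :=
  Matrix.entryLinearMap k k p q ∘ₗ LinearMap.proj i ∘ₗ e.toLinearMap

@[simp] lemma entry_apply (e : A ≃ₐ[k] Π i, Matrix (Fin (d i)) (Fin (d i)) k)
    (i : I) (p q : Fin (d i)) (a : A) : entry e i p q a = e a i p q := rfl

/-- Different blocks do not interact in a Casimir family. -/
lemma sum_entry_of_ne (e : A ≃ₐ[k] Π i, Matrix (Fin (d i)) (Fin (d i)) k)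
    (h : IsCasimir k s x y) {i i' : I} (hi : i ≠ i')
    (p q : Fin (d i)) (p' q' : Fin (d i')) :
    ∑ j ∈ s, e (x j) i p q * e (y j) i' p' q' = 0 := by
  classical
  simpa [Pi.single_eq_of_ne hi.symm] using
    h.sum_smul (entry e i p q) (entry e i' p' q') (e.symm (Pi.single i 1))

/-- Within a block of size `d`, a Casimir family `(x, y)` is determined, up to the factor `d`, by
the block of `∑ yⱼ xⱼ`. -/
lemma sum_entry_self (e : A ≃ₐ[k] Π i, Matrix (Fin (d i)) (Fin (d i)) k)
    (h : IsCasimir k s x y) (i : I) (q b c r : Fin (d i)) :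
    (d i : k) * ∑ j ∈ s, e (x j) i q b * e (y j) i c r =
      if q = r then e (∑ j ∈ s, y j * x j) i c b else 0 := by
  classical
  -- Move the matrix unit `E_{pq}` across the tensor sign, then sum over `p`.
  have key (p : Fin (d i)) : ∑ j ∈ s, e (x j) i q b * e (y j) i c r =
      if q = r then ∑ j ∈ s, e (y j) i c p * e (x j) i p b else 0 := by
    have := h.sum_smul (entry e i p b) (entry e i c r)
      (e.symm (Pi.single i (Matrix.single p q 1)))
    simp only [entry_apply, map_mul, AlgEquiv.apply_symm_apply, Pi.mul_apply, Pi.single_eq_same,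
      Matrix.single_mul_apply_same, one_mul, smul_eq_mul] at this
    rw [this]
    split_ifs with hqr
    · subst hqr
      simp [mul_comm]
    · simp [Matrix.mul_single_apply_of_ne _ _ _ _ _ (Ne.symm hqr)]
  have hs := Finset.sum_congr (rfl : (Finset.univ : Finset (Fin (d i))) = _) fun p _ => key p
  rw [Finset.sum_const, Finset.card_univ, Fintype.card_fin, nsmul_eq_mul] at hs
  rw [hs]
  split_ifs
  · rw [Finset.sum_comm]
    simp [Matrix.mul_apply, Matrix.sum_apply]
  · simp

/-- If `∑ xⱼ yⱼ` is a nonzero scalar, then `∑ yⱼ xⱼ` does not vanish in any block whose size is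
invertible in the field. -/
lemma block_ne_zero (e : A ≃ₐ[k] Π i, Matrix (Fin (d i)) (Fin (d i)) k)
    (h : IsCasimir k s x y) {c : k} (hc : c ≠ 0)
    (hxy : ∑ j ∈ s, x j * y j = algebraMap k A c) (i : I) (hd : (d i : k) ≠ 0) :
    e (∑ j ∈ s, y j * x j) i ≠ 0 := by
  intro h0
  have hpos : 0 < d i := Nat.pos_of_ne_zero fun h' => hd (by simp [h'])
  let q : Fin (d i) := ⟨0, hpos⟩
  have h1 : e (∑ j ∈ s, x j * y j) i q q = c := by simp [hxy, Matrix.algebraMap_matrix_apply]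
  have h2 : (d i : k) * e (∑ j ∈ s, x j * y j) i q q = 0 := by
    have : e (∑ j ∈ s, x j * y j) i q q = ∑ b, ∑ j ∈ s, e (x j) i q b * e (y j) i b q := by
      rw [Finset.sum_comm]
      simp [Matrix.mul_apply, Matrix.sum_apply]
    rw [this, Finset.mul_sum]
    refine Finset.sum_eq_zero fun b _ => ?_
    rw [h.sum_entry_self e i q b b q, if_pos rfl, h0, Matrix.zero_apply]
  rw [h1] at h2
  exact mul_ne_zero hd hc h2

/-- An element `u` of a product of matrix algebras with `u a = θ(a) u` for some map `θ` is
invertible as soon as none of its blocks vanishes: the left ideal `A u` is two-sided, and each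
block is a simple algebra. -/
lemma isUnit_of_block_ne_zero (e : A ≃ₐ[k] Π i, Matrix (Fin (d i)) (Fin (d i)) k)
    {u : A} {θ : A → A} (hu : ∀ a, u * a = θ a * u)
    (hne : ∀ i, e u i ≠ 0) : IsUnit u := by
  rw [← isUnit_map_iff e, Pi.isUnit_iff]
  intro i
  obtain ⟨p, q, hpq⟩ : ∃ p q, e u i p q ≠ 0 := by
    by_contra! h0
    exact hne i (by ext p q; exact h0 p q)
  -- `1 = ∑ᵣ u_{pq}⁻¹ E_{rp} u E_{qr}`, and each `E_{qr}` can be moved to the left of `u`.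
  have hmove (B : Matrix (Fin (d i)) (Fin (d i)) k) : ∃ B', e u i * B = B' * e u i := by
    classical
    refine ⟨e (θ (e.symm (Pi.single i B))) i, ?_⟩
    have := congrFun (congrArg e (hu (e.symm (Pi.single i B)))) i
    simpa using this
  choose Θ hΘ using hmove
  refine IsUnit.of_mul_eq_one_right
    (a := ∑ r, Matrix.single r p (e u i p q)⁻¹ * Θ (Matrix.single q r 1)) ?_
  rw [Finset.sum_mul]
  simp_rw [mul_assoc, ← hΘ]
  ext a b
  simp only [Matrix.sum_apply]
  rw [Finset.sum_eq_single a]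
  · rw [Matrix.single_mul_apply_same]
    rcases eq_or_ne a b with rfl | hab
    · simp [hpq]
    · simp [hab, Matrix.mul_single_apply_of_ne _ _ _ _ _ hab.symm]
  · intro r _ hr
    exact Matrix.single_mul_apply_of_ne _ _ _ _ _ hr.symm _
  · simp

/-- The character of the regular representation of a product of matrix algebras. -/
lemma trace_mulLeft [Fintype I] (e : A ≃ₐ[k] Π i, Matrix (Fin (d i)) (Fin (d i)) k)
    (a : A) :
    LinearMap.trace k A (LinearMap.mulLeft k a) = ∑ i, (d i : k) * ∑ p, e a i p p := by
  classical
  let b := (Pi.basis fun i => Matrix.stdBasis k (Fin (d i)) (Fin (d i))).map e.symm.toLinearEquiv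
  have hb (i : I) (p q : Fin (d i)) :
      LinearMap.toMatrix b b (LinearMap.mulLeft k a) ⟨i, (p, q)⟩ ⟨i, (p, q)⟩ = e a i p p := by
    have hrepr (z : A) : b.repr z ⟨i, (p, q)⟩ = e z i p q := by
      simp [b, Matrix.stdBasis, Pi.basis_repr]
    have hbas : e (b ⟨i, (p, q)⟩) i = Matrix.single p q 1 := by
      simp [b, Pi.basis_apply, Matrix.stdBasis_eq_single]
    rw [LinearMap.toMatrix_apply, hrepr, LinearMap.mulLeft_apply, map_mul, Pi.mul_apply, hbas]
    simp
  rw [LinearMap.trace_eq_matrix_trace k b, Matrix.trace, Fintype.sum_sigma]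
  refine Finset.sum_congr rfl fun i _ => ?_
  simp_rw [Fintype.sum_prod_type, Matrix.diag_apply, hb]
  simp [Finset.mul_sum]

/-- The trace form of the regular representation, twisted by the inverse of `u = ∑ yⱼ xⱼ`, is dual
to the Casimir family. -/
lemma sum_trace_smul [Fintype I] (e : A ≃ₐ[k] Π i, Matrix (Fin (d i)) (Fin (d i)) k)
    (h : IsCasimir k s x y) {v : A} (hv : v * ∑ j ∈ s, y j * x j = 1) :
    ∑ j ∈ s, LinearMap.trace k A (LinearMap.mulLeft k (v * y j)) • x j = 1 := by
  classical
  apply EmbeddingLike.injective e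
  ext i q b
  have hblock (i' : I) :
      ∑ j ∈ s, ((d i' : k) * ∑ p, e (v * y j) i' p p) * e (x j) i q b =
        if i' = i then (1 : Matrix (Fin (d i)) (Fin (d i)) k) q b else 0 := by
    have hexp : ∑ j ∈ s, ((d i' : k) * ∑ p, e (v * y j) i' p p) * e (x j) i q b =
        ∑ p, ∑ r, e v i' p r *
          ((d i' : k) * ∑ j ∈ s, e (x j) i q b * e (y j) i' r p) := by
      simp only [map_mul, Pi.mul_apply, Matrix.mul_apply, Finset.mul_sum, Finset.sum_mul]
      rw [Finset.sum_comm]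
      refine Finset.sum_congr rfl fun p _ => ?_
      rw [Finset.sum_comm]
      refine Finset.sum_congr rfl fun r _ => Finset.sum_congr rfl fun j _ => ?_
      ring
    rw [hexp]
    split_ifs with hi
    · subst hi
      have h1 := congrFun (congrFun (congrFun (congrArg e hv) i') q) b
      rw [map_mul, Pi.mul_apply, Matrix.mul_apply, map_one, Pi.one_apply] at h1
      simp_rw [h.sum_entry_self e]
      rw [← h1, Finset.sum_eq_single q]
      · simp
      · intro p _ hp
        simp [hp.symm]
      · simp
    · simp [h.sum_entry_of_ne e (Ne.symm hi)]
  have : e (∑ j ∈ s, LinearMap.trace k A (LinearMap.mulLeft k (v * y j)) • x j) i q b =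
      ∑ i', ∑ j ∈ s, ((d i' : k) * ∑ p, e (v * y j) i' p p) * e (x j) i q b := by
    rw [Finset.sum_comm]
    simp only [trace_mulLeft e, map_sum, map_smul, Finset.sum_apply, Pi.smul_apply,
      Matrix.sum_apply, Matrix.smul_apply, smul_eq_mul, Finset.sum_mul]
  simp_rw [this, hblock]
  simp

/-- The trace of an endomorphism, computed from a Casimir family and the dual trace form. -/
lemma trace_eq_sum [Fintype I] [FiniteDimensional k A]
    (e : A ≃ₐ[k] Π i, Matrix (Fin (d i)) (Fin (d i)) k)
    (h : IsCasimir k s x y) {v : A}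
    (hv : v * ∑ j ∈ s, y j * x j = 1) (F : A →ₗ[k] A) :
    LinearMap.trace k A F =
      ∑ j ∈ s, LinearMap.trace k A (LinearMap.mulLeft k (v * (y j * F (x j)))) := by
  let φ : A →ₗ[k] k := LinearMap.trace k A ∘ₗ LinearMap.mul k A ∘ₗ LinearMap.mulLeft k v
  have hφ (a : A) : φ a = LinearMap.trace k A (LinearMap.mulLeft k (v * a)) := rfl
  have hid (z : A) : ∑ j ∈ s, φ (y j * z) • x j = z := by
    have h1 := h.smul_sum LinearMap.id φ z
    simp only [LinearMap.id_apply] at h1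
    have h2 := congrArg (z * ·) (h.sum_trace_smul e hv)
    simp only [← hφ, Finset.mul_sum, mul_smul_comm, mul_one] at h2
    rw [← h1, h2]
  have hF : F = ∑ j ∈ s, (φ ∘ₗ LinearMap.mulLeft k (y j)).smulRight (F (x j)) := by
    ext z
    conv_lhs => rw [← hid z]
    simp
  conv_lhs => rw [hF]
  simp [LinearMap.trace_smulRight, hφ]

end Blocks

end IsCasimir

open Coalgebra HopfAlgebra WithConv

/-! ### Integrals in augmented semisimple algebras -/

/-- A semisimple algebra with an augmentation `ε` contains an element `e` with `a e = ε(a) e` and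
`ε(e) = 1`, found in a complement of the left ideal `ker ε`. -/
lemma exists_mul_eq_smul_of_isSemisimpleRing {k A : Type*} [Field k] [Ring A] [Algebra k A]
    [IsSemisimpleRing A] (ε : A →ₐ[k] k) : ∃ e : A, ε e = 1 ∧ ∀ a, a * e = ε a • e := by
  let K : Submodule A A := RingHom.ker ε
  have hK (a : A) : a ∈ K ↔ ε a = 0 := RingHom.mem_ker
  obtain ⟨J, hJ⟩ := exists_isCompl K
  obtain ⟨c, hc, e, he, hce⟩ : ∃ c ∈ K, ∃ e ∈ J, c + e = 1 :=
    Submodule.mem_sup.1 (hJ.sup_eq_top ▸ Submodule.mem_top)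
  refine ⟨e, ?_, fun a => ?_⟩
  · have := congrArg ε hce
    rwa [map_add, (hK c).1 hc, zero_add, map_one] at this
  · -- `(a - ε(a)) e` lies both in `J` and in the two-sided ideal `ker ε`.
    rw [← sub_eq_zero, ← Submodule.mem_bot A, ← hJ.inf_eq_bot]
    have h1 : a * e - ε a • e = (a - algebraMap k A (ε a)) * e := by
      rw [sub_mul, Algebra.smul_def]
    refine ⟨?_, ?_⟩
    · refine (hK _).2 ?_
      rw [h1]
      simp
    · rw [h1]
      exact J.smul_mem _ he

/-! ### Convolution identities for the antipode -/

section Hopf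

variable {k H : Type*} [Field k] [Ring H] [HopfAlgebra k H]

local notation "S" => antipode k (A := H)

/-- The map `a ↦ f(a) ⊗ 1`, as an element of the convolution algebra of maps `H → H ⊗ H`. -/
def convLeft (f : H →ₗ[k] H) : WithConv (H →ₗ[k] H ⊗[k] H) :=
  toConv ((Algebra.TensorProduct.includeLeft : H →ₐ[k] H ⊗[k] H).toLinearMap ∘ₗ f)

/-- The map `a ↦ 1 ⊗ f(a)`, as an element of the convolution algebra of maps `H → H ⊗ H`. -/
def convRight (f : H →ₗ[k] H) : WithConv (H →ₗ[k] H ⊗[k] H) :=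
  toConv ((Algebra.TensorProduct.includeRight : H →ₐ[k] H ⊗[k] H).toLinearMap ∘ₗ f)

lemma convLeft_mul (f g : WithConv (H →ₗ[k] H)) :
    convLeft (f * g).ofConv = convLeft f.ofConv * convLeft g.ofConv :=
  congrArg toConv (LinearMap.algHom_comp_convMul_distrib _ f g)

lemma convRight_mul (f g : WithConv (H →ₗ[k] H)) :
    convRight (f * g).ofConv = convRight f.ofConv * convRight g.ofConv :=
  congrArg toConv (LinearMap.algHom_comp_convMul_distrib _ f g)

lemma convLeft_one : convLeft (1 : WithConv (H →ₗ[k] H)).ofConv = 1 := by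
  ext a
  simp [convLeft, Algebra.TensorProduct.algebraMap_apply]

lemma convRight_one : convRight (1 : WithConv (H →ₗ[k] H)).ofConv = 1 := by
  ext a
  simp [convRight, Algebra.algebraMap_eq_smul_one, Algebra.TensorProduct.one_def]

lemma convLeft_mul_convRight_apply (f g : H →ₗ[k] H) (a : H) :
    (convLeft f * convRight g) a = TensorProduct.map f g (comul a) := by
  rw [(ℛ k a).convMul_apply, ← (ℛ k a).eq]
  simp [convLeft, convRight]

lemma convRight_mul_convLeft_apply (f g : H →ₗ[k] H) (a : H) :
    (convRight f * convLeft g) a = TensorProduct.comm k H H (TensorProduct.map f g (comul a)) := by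
  rw [(ℛ k a).convMul_apply, ← (ℛ k a).eq]
  simp [convLeft, convRight]

/-- The comultiplication is the convolution product of the two inclusions. -/
lemma convLeft_mul_convRight_id :
    convLeft LinearMap.id * convRight LinearMap.id = toConv (comul : H →ₗ[k] H ⊗[k] H) := by
  ext a
  rw [convLeft_mul_convRight_apply]
  simp

/-- The antipode is anti-comultiplicative: both sides are convolution inverse to `comul`. -/
lemma comul_antipode (a : H) :
    comul (R := k) (S a) = TensorProduct.comm k H H (TensorProduct.map S S (comul a)) := by
  have h1 : convRight S * convLeft S * toConv (comul : H →ₗ[k] H ⊗[k] H) = 1 := by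
    rw [← convLeft_mul_convRight_id, mul_assoc, ← mul_assoc (convLeft S),
      ← convLeft_mul (toConv S) (toConv LinearMap.id), LinearMap.antipode_mul_id, convLeft_one,
      one_mul, ← convRight_mul (toConv S) (toConv LinearMap.id), LinearMap.antipode_mul_id,
      convRight_one]
  have h2 := left_inv_eq_right_inv h1 LinearMap.comul_right_inv
  rw [← convRight_mul_convLeft_apply, h2]
  rfl

/-- `∑ (S(a₁) ⊗ 1) Δ(a₂) = 1 ⊗ a`. -/
lemma convLeft_antipode_mul_comul :
    convLeft S * toConv (comul : H →ₗ[k] H ⊗[k] H) = convRight LinearMap.id := by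
  rw [← convLeft_mul_convRight_id, ← mul_assoc, ← convLeft_mul (toConv S) (toConv LinearMap.id),
    LinearMap.antipode_mul_id, convLeft_one, one_mul]

/-- `∑ Δ(a₁) (1 ⊗ S(a₂)) = a ⊗ 1`. -/
lemma comul_mul_convRight_antipode :
    toConv (comul : H →ₗ[k] H ⊗[k] H) * convRight S = convLeft LinearMap.id := by
  rw [← convLeft_mul_convRight_id, mul_assoc, ← convRight_mul (toConv LinearMap.id) (toConv S),
    LinearMap.id_mul_antipode, convRight_one, mul_one]

/-! ### The coproduct of an integral -/

/-- The counit axiom `∑ ε(a₂) a₁ = a`. -/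
lemma sum_smul_counit {a : H} {ι : Type*} (r : Coalgebra.Repr k a ι) :
    ∑ j ∈ r.index, counit (R := k) (r.right j) • r.left j = a := by
  have := congrArg (TensorProduct.rid k H) (sum_tmul_counit_eq r)
  rwa [map_sum, TensorProduct.rid_tmul, one_smul] at this

/-- If `Λ` is a left integral, then `Λ₁ ⊗ a Λ₂ = S(a) Λ₁ ⊗ Λ₂`. -/
lemma HopfFS.IsLeftIntegral.one_tmul_mul_comul {Λ : H} (hΛ : HopfFS.IsLeftIntegral k Λ) (a : H) :
    (1 ⊗ₜ a) * comul (R := k) Λ = (S a ⊗ₜ 1) * comul (R := k) Λ := by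
  have h : (1 : H) ⊗ₜ[k] a = (convRight LinearMap.id : WithConv (H →ₗ[k] H ⊗[k] H)) a := by
    simp [convRight]
  have h2 (b : H) : comul (R := k) b * comul (R := k) Λ = counit (R := k) b • comul (R := k) Λ := by
    rw [← Bialgebra.comul_mul, hΛ b, map_smul]
  have h3 := congrArg S (sum_smul_counit (ℛ k a))
  rw [h, ← convLeft_antipode_mul_comul, (ℛ k a).convMul_apply, Finset.sum_mul, ← h3, map_sum,
    TensorProduct.sum_tmul, Finset.sum_mul]
  refine Finset.sum_congr rfl fun i _ => ?_
  simp [convLeft, mul_assoc, h2, ← TensorProduct.smul_tmul']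

/-- If `Λ` is a right integral, then `Λ₁ a ⊗ Λ₂ = Λ₁ ⊗ Λ₂ S(a)`. -/
lemma comul_mul_tmul_one {Λ : H} (hΛ : ∀ h : H, Λ * h = counit (R := k) h • Λ) (a : H) :
    comul (R := k) Λ * (a ⊗ₜ 1) = comul (R := k) Λ * (1 ⊗ₜ S a) := by
  have h : a ⊗ₜ[k] (1 : H) = (convLeft LinearMap.id : WithConv (H →ₗ[k] H ⊗[k] H)) a := by
    simp [convLeft]
  have h2 (b : H) : comul (R := k) Λ * comul (R := k) b = counit (R := k) b • comul (R := k) Λ := by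
    rw [← Bialgebra.comul_mul, hΛ b, map_smul]
  have h3 := congrArg S (sum_counit_smul (ℛ k a))
  rw [h, ← comul_mul_convRight_antipode, (ℛ k a).convMul_apply, Finset.mul_sum, ← h3, map_sum,
    TensorProduct.tmul_sum, Finset.mul_sum]
  refine Finset.sum_congr rfl fun i _ => ?_
  simp [convRight, ← mul_assoc, h2]

/-- The antipode is injective if there is a left integral `Λ` with `ε(Λ) ≠ 0`. If `S(a) = 0` then
`Λ₁ ⊗ a g Λ₂ = S(a g) Λ₁ ⊗ Λ₂ = 0` for all `g`, and hence `ε(Λ) a = a S(Λ₁) Λ₂ = 0`. -/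
lemma antipode_injective [FiniteDimensional k H] {Λ : H} (hΛ : HopfFS.IsLeftIntegral k Λ)
    (hε : counit (R := k) Λ ≠ 0) : Function.Injective S := by
  rw [injective_iff_map_eq_zero]
  intro a ha
  have h0 (g : H) (f : H →ₗ[k] k) :
      ∑ j ∈ (ℛ k Λ).index, f ((ℛ k Λ).left j) • (a * g * (ℛ k Λ).right j) = 0 := by
    have := hΛ.one_tmul_mul_comul (a * g)
    rw [antipode_mul_antidistrib, ha, mul_zero, TensorProduct.zero_tmul, zero_mul,
      ← (ℛ k Λ).eq] at this
    simpa [Finset.mul_sum] using congrArg (TensorProduct.lift (LinearMap.lsmul k H ∘ₗ f)) this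
  -- Expand the first tensor factor in a basis.
  let b := Module.finBasis k H
  have h1 : a * ∑ j ∈ (ℛ k Λ).index, S ((ℛ k Λ).left j) * (ℛ k Λ).right j = 0 := by
    calc
      _ = ∑ j ∈ (ℛ k Λ).index, ∑ i,
          b.coord i ((ℛ k Λ).left j) • (a * S (b i) * (ℛ k Λ).right j) := by
        rw [Finset.mul_sum]
        refine Finset.sum_congr rfl fun j _ => ?_
        have := congrArg (fun z => a * S z * (ℛ k Λ).right j) (b.sum_repr ((ℛ k Λ).left j))
        simp only [map_sum, map_smul, Finset.mul_sum, Finset.sum_mul, mul_smul_comm,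
          smul_mul_assoc] at this
        rw [← mul_assoc]
        exact this.symm
      _ = 0 := by
        rw [Finset.sum_comm]
        exact Finset.sum_eq_zero fun i _ => h0 _ _
  rw [sum_antipode_mul_eq_smul, mul_smul_comm, mul_one] at h1
  exact (smul_eq_zero.1 h1).resolve_left hε

/-- `u = S(Λ₂) Λ₁` in terms of a representation of `Δ(Λ)`. -/
lemma uElement_eq_sum (Λ : H) :
    HopfFS.uElement k Λ = ∑ j ∈ (ℛ k Λ).index, S ((ℛ k Λ).right j) * (ℛ k Λ).left j := by
  rw [HopfFS.uElement, ← (ℛ k Λ).eq]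
  simp

/-- For a right integral `Λ`, `u a = S²(a) u`. -/
lemma uElement_mul {Λ : H} (hΛ : ∀ h : H, Λ * h = counit (R := k) h • Λ) (a : H) :
    HopfFS.uElement k Λ * a = S (S a) * HopfFS.uElement k Λ := by
  have := congrArg (LinearMap.mul' k H ∘ₗ (antipode k).rTensor H ∘ₗ
    (TensorProduct.comm k H H).toLinearMap) (comul_mul_tmul_one hΛ a)
  rw [← (ℛ k Λ).eq] at this
  simpa [uElement_eq_sum, Finset.mul_sum, Finset.sum_mul, antipode_mul_antidistrib, mul_assoc]
    using this

/-- For a left integral `Λ`, the tensor `Λ₁ ⊗ S(Λ₂)` is a Casimir element. -/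
lemma isCasimir_comul {Λ : H} (hΛ : HopfFS.IsLeftIntegral k Λ) (hS : Function.Surjective S) :
    IsCasimir k (ℛ k Λ).index (ℛ k Λ).left (fun j => S ((ℛ k Λ).right j)) := by
  intro a
  obtain ⟨a, rfl⟩ := hS a
  have := congrArg ((antipode k).lTensor H) (hΛ.one_tmul_mul_comul a)
  rw [← (ℛ k Λ).eq] at this
  simpa [Finset.mul_sum, antipode_mul_antidistrib] using this.symm

/-- In a Hopf algebra with surjective antipode and a left integral `e` with `ε(e) = 1`, every left
integral is a multiple of `e`, is fixed by the antipode and is also a right integral. -/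
lemma HopfFS.IsLeftIntegral.unimodular (hS : Function.Surjective S) {e : H}
    (he : HopfFS.IsLeftIntegral k e) (hε : counit (R := k) e = 1) {Λ : H}
    (hΛ : HopfFS.IsLeftIntegral k Λ) :
    Λ = counit (R := k) Λ • e ∧ S Λ = Λ ∧ ∀ h : H, Λ * h = counit (R := k) h • Λ := by
  have hr (h : H) : S e * h = counit (R := k) h • S e := by
    obtain ⟨h, rfl⟩ := hS h
    rw [← antipode_mul_antidistrib, he h, map_smul, counit_antipode]
  have key {Γ : H} (hΓ : HopfFS.IsLeftIntegral k Γ) : Γ = counit (R := k) Γ • S e := by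
    rw [← hr, hΓ, counit_antipode, hε, one_smul]
  have hSe : S e = e := by simpa [hε] using (key he).symm
  have hΛe : Λ = counit (R := k) Λ • e := by simpa [hSe] using key hΛ
  refine ⟨hΛe, ?_, fun h => ?_⟩
  · rw [hΛe, map_smul, hSe]
  · rw [hΛe, ← hSe, smul_mul_assoc, hr, smul_comm]

/-! ### Sweedler powers and the indicator -/

/-- Convolution powers of a map that commutes with the antipode commute with the antipode, although
composition with the antipode on either side reverses convolution products. -/
lemma antipode_convPow_comm {f : WithConv (H →ₗ[k] H)} (hf : ∀ a, S (f a) = f (S a)) (m : ℕ)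
    (a : H) : S ((f ^ m) a) = (f ^ m) (S a) := by
  induction m generalizing a with
  | zero => simp [Algebra.algebraMap_eq_smul_one]
  | succ m ih =>
    have h1 : S ((f ^ m * f) a) =
        ∑ j ∈ (ℛ k a).index, f (S ((ℛ k a).right j)) * (f ^ m) (S ((ℛ k a).left j)) := by
      rw [(ℛ k a).convMul_apply, map_sum]
      simp_rw [antipode_mul_antidistrib, hf, ih]
    have h2 : (f * f ^ m) (S a) =
        ∑ j ∈ (ℛ k a).index, f (S ((ℛ k a).right j)) * (f ^ m) (S ((ℛ k a).left j)) := by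
      rw [LinearMap.convMul_apply, comul_antipode, ← (ℛ k a).eq]
      simp
    rw [pow_succ, h1, ← h2, ← pow_succ, pow_succ']

lemma antipode_sweedlerPower (n : ℤ) (a : H) :
    S (HopfFS.sweedlerPower k H n a) = HopfFS.sweedlerPower k H n (S a) := by
  cases n with
  | ofNat m => exact antipode_convPow_comm (f := toConv LinearMap.id) (fun _ => rfl) m a
  | negSucc m => exact antipode_convPow_comm (f := toConv S) (fun _ => rfl) (m + 1) a

/-- `P_{n-1} * id = P_n` in the convolution algebra. -/
lemma sweedlerPower_sub_one_mul_id (n : ℤ) :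
    toConv (HopfFS.sweedlerPower k H (n - 1)) * toConv LinearMap.id =
      toConv (HopfFS.sweedlerPower k H n) := by
  match n with
  | Int.ofNat 0 =>
    change toConv S ^ (0 + 1) * toConv LinearMap.id = toConv LinearMap.id ^ 0
    simp
  | Int.ofNat (m + 1) =>
    have : Int.ofNat (m + 1) - 1 = Int.ofNat m := by simp
    rw [this]
    exact (pow_succ _ _).symm
  | Int.negSucc m =>
    change toConv S ^ (m + 1 + 1) * toConv LinearMap.id = toConv S ^ (m + 1)
    rw [pow_succ, mul_assoc, LinearMap.antipode_mul_id, mul_one]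

/-- The indicator of the regular representation as a trace, given that `u` is invertible: the trace
of `S ∘ P_{n-1}` is expanded in the dual bases `Λ₁`, `S(Λ₂)`. -/
lemma fsIndicator_eq_trace [FiniteDimensional k H] {I : Type*} [Fintype I] {d : I → ℕ}
    (e : H ≃ₐ[k] Π i, Matrix (Fin (d i)) (Fin (d i)) k) {Λ : H} (hΛ : HopfFS.IsLeftIntegral k Λ)
    (hS : Function.Surjective S) (hSΛ : S Λ = Λ) (hu : IsUnit (HopfFS.uElement k Λ)) (n : ℤ) :
    HopfFS.fsIndicator k H Λ n =
      LinearMap.trace k H (S ∘ₗ HopfFS.sweedlerPower k H (n - 1)) := by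
  have hv : Ring.inverse (HopfFS.uElement k Λ) *
      ∑ j ∈ (ℛ k Λ).index, S ((ℛ k Λ).right j) * (ℛ k Λ).left j = 1 := by
    rw [← uElement_eq_sum, Ring.inverse_mul_cancel _ hu]
  -- `∑ S(Λ₂) S(P_{n-1}(Λ₁)) = S(∑ P_{n-1}(Λ₁) Λ₂) = S(P_n(Λ)) = P_n(S(Λ)) = P_n(Λ)`.
  have hP : ∑ j ∈ (ℛ k Λ).index, S ((ℛ k Λ).right j) *
      S (HopfFS.sweedlerPower k H (n - 1) ((ℛ k Λ).left j)) = HopfFS.sweedlerPower k H n Λ := by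
    have h1 := congrArg S (LinearMap.congr_fun
      (congrArg ofConv (sweedlerPower_sub_one_mul_id (k := k) (H := H) n)) Λ)
    rw [ofConv_toConv, antipode_sweedlerPower, hSΛ] at h1
    rw [← h1]
    refine Eq.trans ?_ (congrArg S ((ℛ k Λ).convMul_apply _ _).symm)
    simp [map_sum, antipode_mul_antidistrib]
  rw [(isCasimir_comul hΛ hS).trace_eq_sum e hv, HopfFS.fsIndicator, HopfFS.character, ← hP,
    Finset.mul_sum, map_sum, map_sum]
  rfl

end Hopf

/-- Over a field whose characteristic is zero or exceeds the square root of the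
dimension, the sizes of the Wedderburn blocks are invertible, since their squares add up to the
dimension. -/
lemma cast_block_size_ne_zero {k A I : Type*} [Field k] [Ring A] [Algebra k A] [Fintype I]
    {d : I → ℕ} [∀ i, NeZero (d i)] (e : A ≃ₐ[k] Π i, Matrix (Fin (d i)) (Fin (d i)) k)
    (p : ℕ) [CharP k p] (hp : p = 0 ∨ Real.sqrt (Module.finrank k A : ℝ) < (p : ℝ)) (i : I) :
    (d i : k) ≠ 0 := by
  rw [Ne, CharP.cast_eq_zero_iff k p]
  intro hdvd
  rcases hp with rfl | hp
  · exact NeZero.ne _ (zero_dvd_iff.1 hdvd)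
  · have hle : p ≤ d i := Nat.le_of_dvd (NeZero.pos _) hdvd
    have hdim : d i * d i ≤ Module.finrank k A := by
      rw [e.toLinearEquiv.finrank_eq, Module.finrank_pi_fintype]
      simp only [Module.finrank_matrix, Fintype.card_fin, Module.finrank_self, mul_one]
      exact Finset.single_le_sum (f := fun i => d i * d i) (fun _ _ => Nat.zero_le _)
        (Finset.mem_univ i)
    rw [Real.sqrt_lt' (lt_of_le_of_lt (Real.sqrt_nonneg _) hp), sq] at hp
    have : Module.finrank k A < p * p := by exact_mod_cast hp
    exact absurd (this.trans_le (Nat.mul_le_mul hle hle)) (not_lt.2 hdim)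

theorem mainTheorem6 {k H : Type*} [Field k] [IsAlgClosed k] [Ring H] [HopfAlgebra k H]
    [FiniteDimensional k H] [IsSemisimpleRing H] (p : ℕ) [CharP k p]
    (hp : p = 0 ∨ Real.sqrt (Module.finrank k H : ℝ) < (p : ℝ)) :
    (∃ Λ : H, Λ ≠ 0 ∧ HopfFS.IsLeftIntegral k Λ) ∧
    ∀ Λ : H, Λ ≠ 0 → HopfFS.IsLeftIntegral k Λ →
      IsUnit (HopfFS.uElement k Λ) ∧
      ∀ n : ℤ, HopfFS.fsIndicator k H Λ n =
        LinearMap.trace k H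
          ((HopfAlgebra.antipode k : H →ₗ[k] H) ∘ₗ HopfFS.sweedlerPower k H (n - 1)) := by
  obtain ⟨Λ₀, hε₀, h₀⟩ := exists_mul_eq_smul_of_isSemisimpleRing (Bialgebra.counitAlgHom k H)
  replace hε₀ : counit (R := k) Λ₀ = 1 := hε₀
  replace h₀ : HopfFS.IsLeftIntegral k Λ₀ := h₀
  refine ⟨⟨Λ₀, fun h => by simp [h] at hε₀, h₀⟩, fun Λ hne hΛ => ?_⟩
  have hS : Function.Surjective (antipode k : H →ₗ[k] H) :=
    LinearMap.injective_iff_surjective.1 (antipode_injective h₀ (hε₀ ▸ one_ne_zero))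
  obtain ⟨hmul, hSΛ, hr⟩ := HopfFS.IsLeftIntegral.unimodular hS h₀ hε₀ hΛ
  have hε : counit (R := k) Λ ≠ 0 := fun h => hne (by rw [hmul, h, zero_smul])
  obtain ⟨_, d, _, ⟨e⟩⟩ := IsSemisimpleRing.exists_algEquiv_pi_matrix_of_isAlgClosed k H
  have hu : IsUnit (HopfFS.uElement k Λ) := by
    refine IsCasimir.isUnit_of_block_ne_zero e (uElement_mul hr) fun i => ?_
    rw [uElement_eq_sum]
    exact (isCasimir_comul hΛ hS).block_ne_zero e hε
      (sum_mul_antipode_eq_algebraMap_counit (ℛ k Λ)) i (cast_block_size_ne_zero e p hp i)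
  exact ⟨hu, fsIndicator_eq_trace e hΛ hS hSΛ hu⟩
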